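/- **Setting.** Let $\mathbb A$ be a (pseudo) double category with vertical category $\mathbb A_0$, horizontal category $\mathbb A_1$ (objects: 1-cells $M : A \nrightarrow B$; morphisms: 2-cells), functors $L, R : \mathbb A_1 \to \mathbb A_0$ (left and right vertical arrow of a 2-cell), unit functor $U : \mathbb A_0 \to \mathbb A_1$ and horizontal composition $\odot$, which is associative and unital up to coherent natural globular isomorphisms. For 0-cells $A, B$ let $\mathcal A(A,B)$ be the local category of 1-cells $A \nrightarrow B$ and globular 2-cells (those whose two vertical arrows are identities). $\mathbb A$ is *framed* if $(L,R) : \mathbb A_1 \to \mathbb A_0 \times \mathbb A_0$ is a bifibration; fix chosen cartesian 2-cells $f^*Mg^* \to M$ and cocartesian 2-cells $M \to f_!Mg_!$ over $(f,g)$, which define restriction functors $f^*(-)g^*$ and extension functors $f_!(-)g_!$ between local categories. When $f$ or $g$ is an identity it is omitted from the notation. $\mathbb A$ is *abelian* if all local categories are abelian and $\odot$ is additive in each variable on them. Suppose that $\mathbb A$ is *module-like*: it is an abelian framed bicategory with an initial object $I$ of $\mathbb A_0$; all local categories are cocomplete; all functors $M \odot (-)$ and $(-) \odot N$ between local categories have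 right adjoints; all restriction functors are faithful; and $U_I$ is a compact projective generator of $\mathcal A(I,I)$ (i.e. it is projective, and $\mathrm{Hom}(U_I,-)$ is conservative and preserves filtered colimits). Write $\iota_A : I \to A$ for the unique vertical arrow. Endomorphism rings of 1-cells are taken in the local categories, with composition as multiplication. For a vertical arrow $f : A \to B$, the ring $\mathrm{End}(U_A)$ is commutative and $p \mapsto f_!p$ and $p \mapsto p f_!$ make $\mathrm{End}(f_!U_A)$ and $\mathrm{End}(U_Af_!)$ into $\mathrm{End}(U_A)$-algebras. Let $R(-,I)$ and $R(I,-)$ be the functors from $\mathbb A_0$ to $\mathrm{End}(U_I)$-algebras with $R(A,I) = \mathrm{End}(\iota_{A!}U_I)$ and $R(I,A) = \mathrm{End}(U_I\iota_{A!})$. On $f : A \to B$ they are given as follows: let $\hat f : \iota_{A!}U_I \to \iota_{B!}U_I$ be the unique 2-cell over $(f,\mathrm{id}_I)$ whose composite with the chosen cocartesian 2-cell $U_I \to \iota_{A!}U_I$ is the chosen cocartesian 2-cell $U_I \to \iota_{B!}U_I$; then $R(f,I)(\alpha)$ is the unique globular endomorphism $\beta$ of $\iota_{B!}U_I$ with $\beta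 \circ \hat f = \hat f \circ \alpha$. The map $R(I,f)$ is defined symmetrically. **Proposition 7.34.** There are ring isomorphisms $$\mathrm{swap}_f : \mathrm{End}(f_!U_A) \xrightarrow{\ \cong\ } \mathrm{End}(U_Af_!)^{\mathrm{op}},$$ one for every vertical arrow $f : A \to B$, such that for $A = I$ the maps $\mathrm{swap}_{\iota_M}$, regarded as maps $R(M,I)^{\mathrm{op}} \to R(I,M)$, are the components of a natural isomorphism $R(-,I)^{\mathrm{op}} \Rightarrow R(I,-)$ of functors from $\mathbb A_0$ to $\mathrm{End}(U_I)$-algebras. -/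

import Mathlib

open CategoryTheory CategoryTheory.Limits

universe w z v u

namespace FramedBicat

/-! ## Pseudo double categories -/

/-- An object of the horizontal category: a 1-cell together with its left and right 0-cells. -/
structure OneCell {V : Type u} (H : V → V → Type w) where
  /-- the left 0-cell -/
  left : V
  /-- the right 0-cell -/
  right : V
  /-- the 1-cell itself -/
  cell : H left right

/-- A 1-cell `M : A ⇸ B` as an object of the horizontal category. -/
abbrev OneCell.of {V : Type u} {H : V → V → Type w} {A B : V} (M : H A B) : OneCell H :=
  ⟨A, B, M⟩

open OneCell (of)

/-- A pseudo double category with vertical category `V`.  The objects of the horizontal category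
are the 1-cells `M : A ⇸ B` for all 0-cells `A`, `B`, and its morphisms are the 2-cells.
The functors `L` and `R` send `M : A ⇸ B` to `A` and `B`; only their action on 2-cells has to be
given.  Horizontal composition is defined on the pairs of 2-cells in the fibre product of the
horizontal category with itself over `V`; the constraint isomorphisms are globular, natural in
all 2-cells and satisfy the coherence axioms of a bicategory. -/
class DoubleCategory (V : Type u) [Category.{v} V] where
  /-- 1-cells -/
  Hor : V → V → Type w
  /-- the horizontal category: 1-cells and 2-cells with vertical composition -/
  [horizontal : Category.{z} (OneCell Hor)]
  /-- the left vertical arrow of a 2-cell -/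
  L : ∀ {X Y : OneCell Hor}, (X ⟶ Y) → (X.left ⟶ Y.left)
  L_id : ∀ X : OneCell Hor, L (𝟙 X) = 𝟙 X.left
  L_comp : ∀ {X Y Z : OneCell Hor} (α : X ⟶ Y) (β : Y ⟶ Z), L (α ≫ β) = L α ≫ L β
  /-- the right vertical arrow of a 2-cell -/
  R : ∀ {X Y : OneCell Hor}, (X ⟶ Y) → (X.right ⟶ Y.right)
  R_id : ∀ X : OneCell Hor, R (𝟙 X) = 𝟙 X.right
  R_comp : ∀ {X Y Z : OneCell Hor} (α : X ⟶ Y) (β : Y ⟶ Z), R (α ≫ β) = R α ≫ R β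
  /-- unit 1-cells -/
  U : ∀ A : V, Hor A A
  /-- the unit functor on vertical arrows -/
  Umap : ∀ {A B : V}, (A ⟶ B) → (of (U A) ⟶ of (U B))
  L_Umap : ∀ {A B : V} (f : A ⟶ B), L (Umap f) = f
  R_Umap : ∀ {A B : V} (f : A ⟶ B), R (Umap f) = f
  Umap_id : ∀ A : V, Umap (𝟙 A) = 𝟙 (of (U A))
  Umap_comp : ∀ {A B C : V} (f : A ⟶ B) (g : B ⟶ C), Umap (f ≫ g) = Umap f ≫ Umap g
  /-- horizontal composition of 1-cells -/
  hcomp : ∀ {A B C : V}, Hor A B → Hor B C → Hor A C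
  /-- horizontal composition of 2-cells -/
  hmap : ∀ {A B C A' B' C' : V} {M : Hor A B} {N : Hor B C} {M' : Hor A' B'} {N' : Hor B' C'}
    (α : of M ⟶ of M') (β : of N ⟶ of N'), R α = L β → (of (hcomp M N) ⟶ of (hcomp M' N'))
  L_hmap : ∀ {A B C A' B' C' : V} {M : Hor A B} {N : Hor B C} {M' : Hor A' B'} {N' : Hor B' C'}
    (α : of M ⟶ of M') (β : of N ⟶ of N') (h : R α = L β), L (hmap α β h) = L α
  R_hmap : ∀ {A B C A' B' C' : V} {M : Hor A B} {N : Hor B C} {M' : Hor A' B'} {N' : Hor B' C'}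
    (α : of M ⟶ of M') (β : of N ⟶ of N') (h : R α = L β), R (hmap α β h) = R β
  hmap_id : ∀ {A B C : V} (M : Hor A B) (N : Hor B C),
    hmap (𝟙 (of M)) (𝟙 (of N)) ((R_id (of M)).trans (L_id (of N)).symm) = 𝟙 (of (hcomp M N))
  hmap_comp : ∀ {A B C A' B' C' A'' B'' C'' : V} {M : Hor A B} {N : Hor B C}
    {M' : Hor A' B'} {N' : Hor B' C'} {M'' : Hor A'' B''} {N'' : Hor B'' C''}
    (α : of M ⟶ of M') (β : of N ⟶ of N') (h : R α = L β)
    (α' : of M' ⟶ of M'') (β' : of N' ⟶ of N'') (h' : R α' = L β')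
    (h'' : R (α ≫ α') = L (β ≫ β')),
    hmap (α ≫ α') (β ≫ β') h'' = hmap α β h ≫ hmap α' β' h'
  /-- associativity isomorphism -/
  assoc : ∀ {A B C D : V} (M : Hor A B) (N : Hor B C) (P : Hor C D),
    of (hcomp M (hcomp N P)) ≅ of (hcomp (hcomp M N) P)
  L_assoc : ∀ {A B C D : V} (M : Hor A B) (N : Hor B C) (P : Hor C D),
    L (assoc M N P).hom = 𝟙 A
  R_assoc : ∀ {A B C D : V} (M : Hor A B) (N : Hor B C) (P : Hor C D),
    R (assoc M N P).hom = 𝟙 D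
  assoc_naturality : ∀ {A B C D A' B' C' D' : V} {M : Hor A B} {N : Hor B C} {P : Hor C D}
    {M' : Hor A' B'} {N' : Hor B' C'} {P' : Hor C' D'}
    (α : of M ⟶ of M') (β : of N ⟶ of N') (γ : of P ⟶ of P')
    (h₁ : R α = L β) (h₂ : R β = L γ),
    hmap α (hmap β γ h₂) (h₁.trans (L_hmap β γ h₂).symm) ≫ (assoc M' N' P').hom =
      (assoc M N P).hom ≫ hmap (hmap α β h₁) γ ((R_hmap α β h₁).trans h₂)
  /-- left unit isomorphism -/
  lunit : ∀ {A B : V} (M : Hor A B), of (hcomp (U A) M) ≅ of M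
  L_lunit : ∀ {A B : V} (M : Hor A B), L (lunit M).hom = 𝟙 A
  R_lunit : ∀ {A B : V} (M : Hor A B), R (lunit M).hom = 𝟙 B
  lunit_naturality : ∀ {A B A' B' : V} {M : Hor A B} {M' : Hor A' B'} (α : of M ⟶ of M'),
    hmap (Umap (L α)) α (R_Umap (L α)) ≫ (lunit M').hom = (lunit M).hom ≫ α
  /-- right unit isomorphism -/
  runit : ∀ {A B : V} (M : Hor A B), of (hcomp M (U B)) ≅ of M
  L_runit : ∀ {A B : V} (M : Hor A B), L (runit M).hom = 𝟙 A
  R_runit : ∀ {A B : V} (M : Hor A B), R (runit M).hom = 𝟙 B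
  runit_naturality : ∀ {A B A' B' : V} {M : Hor A B} {M' : Hor A' B'} (α : of M ⟶ of M'),
    hmap α (Umap (R α)) (L_Umap (R α)).symm ≫ (runit M').hom = (runit M).hom ≫ α
  pentagon : ∀ {A B C D E : V} (M : Hor A B) (N : Hor B C) (P : Hor C D) (Q : Hor D E),
    (assoc M N (hcomp P Q)).hom ≫ (assoc (hcomp M N) P Q).hom =
      hmap (𝟙 (of M)) (assoc N P Q).hom ((R_id (of M)).trans (L_assoc N P Q).symm) ≫
        (assoc M (hcomp N P) Q).hom ≫
          hmap (assoc M N P).hom (𝟙 (of Q)) ((R_assoc M N P).trans (L_id (of Q)).symm)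
  triangle : ∀ {A B C : V} (M : Hor A B) (N : Hor B C),
    (assoc M (U B) N).hom ≫
        hmap (runit M).hom (𝟙 (of N)) ((R_runit M).trans (L_id (of N)).symm) =
      hmap (𝟙 (of M)) (lunit N).hom ((R_id (of M)).trans (L_lunit N).symm)

attribute [instance, reducible] DoubleCategory.horizontal

open DoubleCategory

section Double

variable {V : Type u} [Category.{v} V] [DoubleCategory.{w, z} V]

/-! ### Local categories -/

/-- A globular 2-cell: both vertical arrows are identities. -/
@[ext]
structure Glob {A B : V} (M N : Hor A B) where
  /-- the underlying 2-cell -/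
  cell : of M ⟶ of N
  L_cell : L cell = 𝟙 A
  R_cell : R cell = 𝟙 B

/-- The local category of 1-cells `A ⇸ B` and globular 2-cells. -/
instance localCategory (A B : V) : Category.{z} (Hor A B) where
  Hom M N := Glob M N
  id M := ⟨𝟙 (of M), L_id _, R_id _⟩
  comp α β := ⟨α.cell ≫ β.cell, by simp [L_comp, α.L_cell, β.L_cell],
    by simp [R_comp, α.R_cell, β.R_cell]⟩
  id_comp α := Glob.ext (Category.id_comp α.cell)
  comp_id α := Glob.ext (Category.comp_id α.cell)
  assoc α β γ := Glob.ext (Category.assoc α.cell β.cell γ.cell)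

/-- The underlying 2-cell of a morphism of a local category. -/
def toCell {A B : V} {M N : Hor A B} (α : M ⟶ N) : of M ⟶ of N := Glob.cell α

/-- A 2-cell whose vertical arrows are identities as a morphism of a local category. -/
def ofCell {A B : V} {M N : Hor A B} (α : of M ⟶ of N) (hL : L α = 𝟙 A) (hR : R α = 𝟙 B) :
    M ⟶ N :=
  Glob.mk α hL hR

@[simp] lemma toCell_ofCell {A B : V} {M N : Hor A B} (α : of M ⟶ of N) (hL : L α = 𝟙 A)
    (hR : R α = 𝟙 B) : toCell (ofCell α hL hR) = α := rfl

@[simp] lemma toCell_id {A B : V} (M : Hor A B) : toCell (𝟙 M) = 𝟙 (of M) := rfl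

@[simp] lemma toCell_comp {A B : V} {M N P : Hor A B} (α : M ⟶ N) (β : N ⟶ P) :
    toCell (α ≫ β) = toCell α ≫ toCell β := rfl

lemma L_toCell {A B : V} {M N : Hor A B} (α : M ⟶ N) : L (toCell α) = 𝟙 A := Glob.L_cell α

lemma R_toCell {A B : V} {M N : Hor A B} (α : M ⟶ N) : R (toCell α) = 𝟙 B := Glob.R_cell α

lemma toCell_injective {A B : V} {M N : Hor A B} {α β : M ⟶ N} (h : toCell α = toCell β) :
    α = β := Glob.ext h

/-- Horizontal composition of globular 2-cells. -/
def globComp {A B C : V} {M M' : Hor A B} {N N' : Hor B C} (α : M ⟶ M') (β : N ⟶ N') :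
    hcomp M N ⟶ hcomp M' N' :=
  ofCell (hmap (toCell α) (toCell β) ((R_toCell α).trans (L_toCell β).symm))
    ((L_hmap _ _ _).trans (L_toCell α)) ((R_hmap _ _ _).trans (R_toCell β))

lemma globComp_id {A B C : V} (M : Hor A B) (N : Hor B C) :
    globComp (𝟙 M) (𝟙 N) = 𝟙 (hcomp M N) :=
  toCell_injective (hmap_id M N)

lemma globComp_comp {A B C : V} {M M' M'' : Hor A B} {N N' N'' : Hor B C}
    (α : M ⟶ M') (β : N ⟶ N') (α' : M' ⟶ M'') (β' : N' ⟶ N'') :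
    globComp (α ≫ α') (β ≫ β') = globComp α β ≫ globComp α' β' :=
  toCell_injective (hmap_comp _ _ _ _ _ _ _)

/-- The functor `M ⊙ (-)` between local categories. -/
def hcompLeft {A B : V} (M : Hor A B) (C : V) : Hor B C ⥤ Hor A C where
  obj N := hcomp M N
  map β := globComp (𝟙 M) β
  map_id N := globComp_id M N
  map_comp β β' := by rw [← globComp_comp, Category.comp_id]

/-- The functor `(-) ⊙ N` between local categories. -/
def hcompRight (A : V) {B C : V} (N : Hor B C) : Hor A B ⥤ Hor A C where
  obj M := hcomp M N
  map α := globComp α (𝟙 N)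
  map_id M := globComp_id M N
  map_comp α α' := by rw [← globComp_comp, Category.comp_id]

/-! ### Cartesian and cocartesian 2-cells -/

/-- A 2-cell `φ : X ⟶ Y` is cartesian (with respect to `(L, R)`) if every 2-cell `γ` into `Y`
whose vertical arrows factor through those of `φ` factors uniquely through `φ` over the given
factorizations. -/
def IsCartesian {X Y : OneCell (Hor (V := V))} (φ : X ⟶ Y) : Prop :=
  ∀ ⦃Z : OneCell (Hor (V := V))⦄ (γ : Z ⟶ Y) (h : Z.left ⟶ X.left) (k : Z.right ⟶ X.right),
    L γ = h ≫ L φ → R γ = k ≫ R φ → ∃! δ : Z ⟶ X, L δ = h ∧ R δ = k ∧ δ ≫ φ = γ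

/-- A 2-cell `φ : X ⟶ Y` is cocartesian (with respect to `(L, R)`) if every 2-cell `γ` out of `X`
whose vertical arrows factor through those of `φ` factors uniquely through `φ` over the given
factorizations. -/
def IsCocartesian {X Y : OneCell (Hor (V := V))} (φ : X ⟶ Y) : Prop :=
  ∀ ⦃Z : OneCell (Hor (V := V))⦄ (γ : X ⟶ Z) (h : Y.left ⟶ Z.left) (k : Y.right ⟶ Z.right),
    L γ = L φ ≫ h → R γ = R φ ≫ k → ∃! δ : Y ⟶ Z, L δ = h ∧ R δ = k ∧ φ ≫ δ = γ

/-- The functor `(L, R)` from the horizontal category to pairs of 0-cells. -/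
def frame : OneCell (Hor (V := V)) ⥤ V × V where
  obj X := (X.left, X.right)
  map α := (L α, R α)
  map_id X := Prod.ext (L_id X) (R_id X)
  map_comp α β := Prod.ext (L_comp α β) (R_comp α β)

/-- Cartesian 2-cells are the strongly cartesian morphisms of Mathlib for `(L, R)`. -/
lemma isCartesian_iff {X Y : OneCell (Hor (V := V))} (φ : X ⟶ Y) :
    IsCartesian φ ↔ (frame (V := V)).IsStronglyCartesian (frame.map φ) φ := by
  constructor
  · intro h
    refine { universal_property' := ?_ }
    intro Z g γ hγ
    have e := IsHomLift.fac frame (g ≫ frame.map φ) γ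
    simp only [eqToHom_refl, Category.comp_id, Category.id_comp] at e
    obtain ⟨δ, ⟨h1, h2, h3⟩, hu⟩ :=
      h γ g.1 g.2 (congrArg Prod.fst e).symm (congrArg Prod.snd e).symm
    have e' : frame.map δ = g := Prod.ext h1 h2
    refine ⟨δ, ⟨by rw [← e']; infer_instance, h3⟩, ?_⟩
    rintro δ' ⟨hl, h3'⟩
    have e2 := IsHomLift.fac frame g δ'
    simp only [eqToHom_refl, Category.comp_id, Category.id_comp] at e2
    exact hu δ' ⟨(congrArg Prod.fst e2).symm, (congrArg Prod.snd e2).symm, h3'⟩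
  · intro h Z γ a b hL hR
    let g : frame.obj Z ⟶ frame.obj X := (a, b)
    have e : frame.map γ = g ≫ frame.map φ := Prod.ext hL hR
    have : (frame (V := V)).IsHomLift (g ≫ frame.map φ) γ := by
      rw [← e]; infer_instance
    obtain ⟨δ, ⟨hl, h3⟩, hu⟩ := h.universal_property' g γ
    have e2 := IsHomLift.fac frame g δ
    simp only [eqToHom_refl, Category.comp_id, Category.id_comp] at e2
    refine ⟨δ, ⟨(congrArg Prod.fst e2).symm, (congrArg Prod.snd e2).symm, h3⟩, ?_⟩
    rintro δ' ⟨h1, h2, h3'⟩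
    refine hu δ' ⟨?_, h3'⟩
    have : frame.map δ' = g := Prod.ext h1 h2
    rw [← this]; infer_instance

/-- Cocartesian 2-cells are the strongly cocartesian morphisms of Mathlib for `(L, R)`. -/
lemma isCocartesian_iff {X Y : OneCell (Hor (V := V))} (φ : X ⟶ Y) :
    IsCocartesian φ ↔ (frame (V := V)).IsStronglyCocartesian (frame.map φ) φ := by
  constructor
  · intro h
    refine { universal_property' := ?_ }
    intro Z g γ hγ
    have e := IsHomLift.fac frame (frame.map φ ≫ g) γ
    simp only [eqToHom_refl, Category.comp_id, Category.id_comp] at e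
    obtain ⟨δ, ⟨h1, h2, h3⟩, hu⟩ :=
      h γ g.1 g.2 (congrArg Prod.fst e).symm (congrArg Prod.snd e).symm
    have e' : frame.map δ = g := Prod.ext h1 h2
    refine ⟨δ, ⟨by rw [← e']; infer_instance, h3⟩, ?_⟩
    rintro δ' ⟨hl, h3'⟩
    have e2 := IsHomLift.fac frame g δ'
    simp only [eqToHom_refl, Category.comp_id, Category.id_comp] at e2
    exact hu δ' ⟨(congrArg Prod.fst e2).symm, (congrArg Prod.snd e2).symm, h3'⟩
  · intro h Z γ a b hL hR
    let g : frame.obj Y ⟶ frame.obj Z := (a, b)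
    have e : frame.map γ = frame.map φ ≫ g := Prod.ext hL hR
    have : (frame (V := V)).IsHomLift (frame.map φ ≫ g) γ := by
      rw [← e]; infer_instance
    obtain ⟨δ, ⟨hl, h3⟩, hu⟩ := h.universal_property' g γ
    have e2 := IsHomLift.fac frame g δ
    simp only [eqToHom_refl, Category.comp_id, Category.id_comp] at e2
    refine ⟨δ, ⟨(congrArg Prod.fst e2).symm, (congrArg Prod.snd e2).symm, h3⟩, ?_⟩
    rintro δ' ⟨h1, h2, h3'⟩
    refine hu δ' ⟨?_, h3'⟩
    have : frame.map δ' = g := Prod.ext h1 h2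
    rw [← this]; infer_instance

/-- The factorization of a 2-cell through a cartesian 2-cell. -/
noncomputable def IsCartesian.lift {X Y : OneCell (Hor (V := V))} {φ : X ⟶ Y}
    (hφ : IsCartesian φ) {Z : OneCell (Hor (V := V))} (γ : Z ⟶ Y) (h : Z.left ⟶ X.left)
    (k : Z.right ⟶ X.right) (hL : L γ = h ≫ L φ) (hR : R γ = k ≫ R φ) : Z ⟶ X :=
  (hφ γ h k hL hR).choose

section lift

variable {X Y : OneCell (Hor (V := V))} {φ : X ⟶ Y} (hφ : IsCartesian φ)
  {Z : OneCell (Hor (V := V))} (γ : Z ⟶ Y) (h : Z.left ⟶ X.left) (k : Z.right ⟶ X.right)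
  (hL : L γ = h ≫ L φ) (hR : R γ = k ≫ R φ)

lemma IsCartesian.L_lift : L (hφ.lift γ h k hL hR) = h := (hφ γ h k hL hR).choose_spec.1.1

lemma IsCartesian.R_lift : R (hφ.lift γ h k hL hR) = k := (hφ γ h k hL hR).choose_spec.1.2.1

lemma IsCartesian.fac : hφ.lift γ h k hL hR ≫ φ = γ := (hφ γ h k hL hR).choose_spec.1.2.2

lemma IsCartesian.hom_ext {X Y : OneCell (Hor (V := V))} {φ : X ⟶ Y} (hφ : IsCartesian φ)
    {Z : OneCell (Hor (V := V))} {δ δ' : Z ⟶ X} (hL : L δ = L δ') (hR : R δ = R δ')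
    (h : δ ≫ φ = δ' ≫ φ) : δ = δ' :=
  (hφ (δ' ≫ φ) (L δ') (R δ') (L_comp _ _) (R_comp _ _)).unique ⟨hL, hR, h⟩ ⟨rfl, rfl, rfl⟩

end lift

/-- The factorization of a 2-cell through a cocartesian 2-cell. -/
noncomputable def IsCocartesian.desc {X Y : OneCell (Hor (V := V))} {φ : X ⟶ Y}
    (hφ : IsCocartesian φ) {Z : OneCell (Hor (V := V))} (γ : X ⟶ Z) (h : Y.left ⟶ Z.left)
    (k : Y.right ⟶ Z.right) (hL : L γ = L φ ≫ h) (hR : R γ = R φ ≫ k) : Y ⟶ Z :=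
  (hφ γ h k hL hR).choose

section desc

variable {X Y : OneCell (Hor (V := V))} {φ : X ⟶ Y} (hφ : IsCocartesian φ)
  {Z : OneCell (Hor (V := V))} (γ : X ⟶ Z) (h : Y.left ⟶ Z.left) (k : Y.right ⟶ Z.right)
  (hL : L γ = L φ ≫ h) (hR : R γ = R φ ≫ k)

lemma IsCocartesian.L_desc : L (hφ.desc γ h k hL hR) = h := (hφ γ h k hL hR).choose_spec.1.1

lemma IsCocartesian.R_desc : R (hφ.desc γ h k hL hR) = k := (hφ γ h k hL hR).choose_spec.1.2.1

lemma IsCocartesian.fac : φ ≫ hφ.desc γ h k hL hR = γ := (hφ γ h k hL hR).choose_spec.1.2.2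

lemma IsCocartesian.hom_ext {X Y : OneCell (Hor (V := V))} {φ : X ⟶ Y} (hφ : IsCocartesian φ)
    {Z : OneCell (Hor (V := V))} {δ δ' : Y ⟶ Z} (hL : L δ = L δ') (hR : R δ = R δ')
    (h : φ ≫ δ = φ ≫ δ') : δ = δ' :=
  (hφ (φ ≫ δ') (L δ') (R δ') (L_comp _ _) (R_comp _ _)).unique ⟨hL, hR, h⟩ ⟨rfl, rfl, rfl⟩

end desc

/-- If `φ` and `φ ≫ ψ` are cocartesian, then so is `ψ`. -/
lemma IsCocartesian.of_comp {X Y Z : OneCell (Hor (V := V))} {φ : X ⟶ Y} {ψ : Y ⟶ Z}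
    (hφ : IsCocartesian φ) (hφψ : IsCocartesian (φ ≫ ψ)) : IsCocartesian ψ := by
  intro T γ h k hL hR
  obtain ⟨δ, ⟨h1, h2, h3⟩, huniq⟩ := hφψ (φ ≫ γ) h k
    (by rw [L_comp, L_comp, hL, Category.assoc]) (by rw [R_comp, R_comp, hR, Category.assoc])
  refine ⟨δ, ⟨h1, h2, hφ.hom_ext ?_ ?_ ?_⟩, ?_⟩
  · rw [L_comp, h1, hL]
  · rw [R_comp, h2, hR]
  · rw [← h3, Category.assoc]
  · rintro δ' ⟨h1', h2', h3'⟩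
    exact huniq δ' ⟨h1', h2', by rw [Category.assoc, h3']⟩

/-- The endomorphism `β` of `N` with `c ≫ β = α ≫ c`, for a cocartesian 2-cell `c : M ⟶ N`. -/
noncomputable def pushCell {A B C D : V} {M : Hor A B} {N : Hor C D} {c : of M ⟶ of N}
    (hc : IsCocartesian c) (α : End M) : End N :=
  ofCell (hc.desc (toCell α ≫ c) (𝟙 C) (𝟙 D) (by simp [L_comp, L_toCell])
    (by simp [R_comp, R_toCell])) (IsCocartesian.L_desc ..) (IsCocartesian.R_desc ..)

lemma comp_pushCell {A B C D : V} {M : Hor A B} {N : Hor C D} {c : of M ⟶ of N}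
    (hc : IsCocartesian c) (α : End M) : c ≫ toCell (pushCell hc α) = toCell α ≫ c :=
  IsCocartesian.fac ..

lemma eq_pushCell {A B C D : V} {M : Hor A B} {N : Hor C D} {c : of M ⟶ of N}
    (hc : IsCocartesian c) (α : End M) (β : End N) (h : c ≫ toCell β = toCell α ≫ c) :
    β = pushCell hc α :=
  toCell_injective <| hc.hom_ext (by rw [L_toCell, L_toCell]) (by rw [R_toCell, R_toCell])
    (h.trans (comp_pushCell hc α).symm)

/-! ### The action of endomorphisms of unit 1-cells -/

lemma runit_nat {A B B' : V} {M : Hor B A} {M' : Hor B' A} (α : of M ⟶ of M')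
    (hα : R α = 𝟙 A) :
    hmap α (𝟙 (of (U A))) (hα.trans (L_id (of (U A))).symm) ≫ (runit M').hom =
      (runit M).hom ≫ α := by
  have key : ∀ (β : of (U A) ⟶ of (U A)) (hβ : β = Umap (R α)) (h : R α = L β),
      hmap α β h ≫ (runit M').hom = (runit M).hom ≫ α := by
    rintro _ rfl h
    exact runit_naturality α
  exact key _ (by rw [← Umap_id]; exact congrArg Umap hα.symm) _

lemma lunit_nat {A B B' : V} {M : Hor A B} {M' : Hor A B'} (α : of M ⟶ of M')
    (hα : L α = 𝟙 A) :
    hmap (𝟙 (of (U A))) α ((R_id (of (U A))).trans hα.symm) ≫ (lunit M').hom =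
      (lunit M).hom ≫ α := by
  have key : ∀ (β : of (U A) ⟶ of (U A)) (hβ : β = Umap (L α)) (h : R β = L α),
      hmap β α h ≫ (lunit M').hom = (lunit M).hom ≫ α := by
    rintro _ rfl h
    exact lunit_naturality α
  exact key _ (by rw [← Umap_id]; exact congrArg Umap hα.symm) _

lemma hmap_congr {A B C A' B' C' : V} {M : Hor A B} {N : Hor B C} {M' : Hor A' B'}
    {N' : Hor B' C'} {α α' : of M ⟶ of M'} {β β' : of N ⟶ of N'} (hα : α = α') (hβ : β = β')
    (h : R α = L β) (h' : R α' = L β') : hmap α β h = hmap α' β' h' := by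
  subst hα hβ
  rfl

/-- `r ∘ (id ⊙ p) ∘ r⁻¹`, for `X : B ⇸ A` and `p` an endomorphism of `U_A`. -/
def actR {A B : V} (X : Hor B A) (p : of (U A) ⟶ of (U A)) (hp : L p = 𝟙 A) : of X ⟶ of X :=
  (runit X).inv ≫ hmap (𝟙 (of X)) p ((R_id (of X)).trans hp.symm) ≫ (runit X).hom

/-- `l ∘ (p ⊙ id) ∘ l⁻¹`, for `X : A ⇸ B` and `p` an endomorphism of `U_A`. -/
def actL {A B : V} (X : Hor A B) (p : of (U A) ⟶ of (U A)) (hp : R p = 𝟙 A) : of X ⟶ of X :=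
  (lunit X).inv ≫ hmap p (𝟙 (of X)) (hp.trans (L_id (of X)).symm) ≫ (lunit X).hom

lemma actR_comm {A B B' : V} {X : Hor B A} {Y : Hor B' A} (p : of (U A) ⟶ of (U A))
    (hp : L p = 𝟙 A) (c : of X ⟶ of Y) (hc : R c = 𝟙 A) :
    c ≫ actR Y p hp = actR X p hp ≫ c := by
  unfold actR
  rw [Category.assoc, Category.assoc, ← runit_nat c hc, ← cancel_epi (runit X).hom,
    Iso.hom_inv_id_assoc, ← Category.assoc, ← runit_nat c hc, Category.assoc,
    Iso.hom_inv_id_assoc, ← Category.assoc, ← Category.assoc]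
  congr 1
  rw [← hmap_comp _ _ _ _ _ _ (by rw [R_comp, L_comp, hc, hp, R_id, L_id]),
    ← hmap_comp _ _ _ _ _ _ (by rw [R_comp, L_comp, hc, hp, R_id, L_id])]
  exact hmap_congr (by simp) (by simp) _ _

lemma actL_comm {A B B' : V} {X : Hor A B} {Y : Hor A B'} (p : of (U A) ⟶ of (U A))
    (hp : R p = 𝟙 A) (c : of X ⟶ of Y) (hc : L c = 𝟙 A) :
    c ≫ actL Y p hp = actL X p hp ≫ c := by
  unfold actL
  rw [Category.assoc, Category.assoc, ← lunit_nat c hc, ← cancel_epi (lunit X).hom,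
    Iso.hom_inv_id_assoc, ← Category.assoc, ← lunit_nat c hc, Category.assoc,
    Iso.hom_inv_id_assoc, ← Category.assoc, ← Category.assoc]
  congr 1
  rw [← hmap_comp _ _ _ _ _ _ (by rw [R_comp, L_comp, hc, hp, R_id, L_id]),
    ← hmap_comp _ _ _ _ _ _ (by rw [R_comp, L_comp, hc, hp, R_id, L_id])]
  exact hmap_congr (by simp) (by simp) _ _

lemma L_inv_eq {A : V} {X Y : OneCell (Hor (V := V))} (e : X ≅ Y) (hX : X.left = A)
    (hY : Y.left = A) (h : L e.hom = eqToHom (hX.trans hY.symm)) :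
    L e.inv = eqToHom (hY.trans hX.symm) := by
  have h1 : L e.hom ≫ L e.inv = 𝟙 _ := by rw [← L_comp, e.hom_inv_id, L_id]
  rw [h] at h1
  simpa using congrArg (eqToHom (hY.trans hX.symm) ≫ ·) h1

lemma R_inv_eq {A : V} {X Y : OneCell (Hor (V := V))} (e : X ≅ Y) (hX : X.right = A)
    (hY : Y.right = A) (h : R e.hom = eqToHom (hX.trans hY.symm)) :
    R e.inv = eqToHom (hY.trans hX.symm) := by
  have h1 : R e.hom ≫ R e.inv = 𝟙 _ := by rw [← R_comp, e.hom_inv_id, R_id]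
  rw [h] at h1
  simpa using congrArg (eqToHom (hY.trans hX.symm) ≫ ·) h1

lemma L_actR {A B : V} (X : Hor B A) (p : of (U A) ⟶ of (U A)) (hp : L p = 𝟙 A) :
    L (actR X p hp) = 𝟙 B := by
  have h := L_inv_eq (runit X) rfl rfl (L_runit X)
  rw [actR, L_comp, L_comp, L_hmap, L_id, h, L_runit]
  simp

lemma R_actR {A B : V} (X : Hor B A) (p : of (U A) ⟶ of (U A)) (hp : L p = 𝟙 A)
    (hp' : R p = 𝟙 A) : R (actR X p hp) = 𝟙 A := by
  have h := R_inv_eq (runit X) rfl rfl (R_runit X)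
  rw [actR, R_comp, R_comp, R_hmap, hp', h, R_runit]
  simp

lemma R_actL {A B : V} (X : Hor A B) (p : of (U A) ⟶ of (U A)) (hp : R p = 𝟙 A) :
    R (actL X p hp) = 𝟙 B := by
  have h := R_inv_eq (lunit X) rfl rfl (R_lunit X)
  rw [actL, R_comp, R_comp, R_hmap, R_id, h, R_lunit]
  simp

lemma L_actL {A B : V} (X : Hor A B) (p : of (U A) ⟶ of (U A)) (hp : R p = 𝟙 A)
    (hp' : L p = 𝟙 A) : L (actL X p hp) = 𝟙 A := by
  have h := L_inv_eq (lunit X) rfl rfl (L_lunit X)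
  rw [actL, L_comp, L_comp, L_hmap, hp', h, L_lunit]
  simp

lemma actR_unit {A : V} (p : of (U A) ⟶ of (U A)) (hp : L p = 𝟙 A) :
    actR (U A) p hp = p := by
  have h1 : actR (U A) p hp =
      (runit (U A)).inv ≫ (lunit (U A)).hom ≫ p ≫ (lunit (U A)).inv ≫ (runit (U A)).hom := by
    rw [← Category.assoc _ p, ← lunit_nat p hp]
    simp [actR]
  have h2 := actR_comm p hp ((lunit (U A)).inv ≫ (runit (U A)).hom)
    (by
      rw [R_comp, R_runit, R_inv_eq (lunit (U A)) rfl rfl (R_lunit _)]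
      simp)
  rw [← cancel_mono ((lunit (U A)).inv ≫ (runit (U A)).hom), ← h2, h1]
  simp

lemma actL_unit {A : V} (p : of (U A) ⟶ of (U A)) (hp : R p = 𝟙 A) :
    actL (U A) p hp = p := by
  have h1 : actL (U A) p hp =
      (lunit (U A)).inv ≫ (runit (U A)).hom ≫ p ≫ (runit (U A)).inv ≫ (lunit (U A)).hom := by
    rw [← Category.assoc _ p, ← runit_nat p hp]
    simp [actL]
  have h2 := actL_comm p hp ((runit (U A)).inv ≫ (lunit (U A)).hom)
    (by
      rw [L_comp, L_lunit, L_inv_eq (runit (U A)) rfl rfl (L_runit _)]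
      simp)
  rw [← cancel_mono ((runit (U A)).inv ≫ (lunit (U A)).hom), ← h2, h1]
  simp

end Double

/-! ## Framed bicategories -/

/-- A framed bicategory: a double category such that `(L, R)` is a bifibration, equipped with a
cleavage, i.e. a choice of cartesian and cocartesian lifts.  (The cleavage is arbitrary: it need
not be normal.) -/
class FramedBicategory (V : Type u) [Category.{v} V] extends DoubleCategory.{w, z} V where
  /-- the restriction `f^* M g^*` -/
  res : ∀ {A B C D : V}, (A ⟶ C) → (B ⟶ D) → Hor C D → Hor A B
  /-- the chosen cartesian 2-cell `f^* M g^* ⟶ M` -/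
  cart : ∀ {A B C D : V} (f : A ⟶ C) (g : B ⟶ D) (M : Hor C D), of (res f g M) ⟶ of M
  L_cart : ∀ {A B C D : V} (f : A ⟶ C) (g : B ⟶ D) (M : Hor C D), L (cart f g M) = f
  R_cart : ∀ {A B C D : V} (f : A ⟶ C) (g : B ⟶ D) (M : Hor C D), R (cart f g M) = g
  isCartesian_cart : ∀ {A B C D : V} (f : A ⟶ C) (g : B ⟶ D) (M : Hor C D),
    IsCartesian (cart f g M)
  /-- the extension `f_! M g_!` -/
  ext : ∀ {A B C D : V}, (A ⟶ C) → (B ⟶ D) → Hor A B → Hor C D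
  /-- the chosen cocartesian 2-cell `M ⟶ f_! M g_!` -/
  cocart : ∀ {A B C D : V} (f : A ⟶ C) (g : B ⟶ D) (M : Hor A B), of M ⟶ of (ext f g M)
  L_cocart : ∀ {A B C D : V} (f : A ⟶ C) (g : B ⟶ D) (M : Hor A B), L (cocart f g M) = f
  R_cocart : ∀ {A B C D : V} (f : A ⟶ C) (g : B ⟶ D) (M : Hor A B), R (cocart f g M) = g
  isCocartesian_cocart : ∀ {A B C D : V} (f : A ⟶ C) (g : B ⟶ D) (M : Hor A B),
    IsCocartesian (cocart f g M)

open FramedBicategory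

section Framed

variable {V : Type u} [Category.{v} V] [FramedBicategory.{w, z} V]

/-- The restriction of scalars functor `f^* (-) g^*`. -/
@[reducible] noncomputable def restriction {A B C D : V} (f : A ⟶ C) (g : B ⟶ D) : Hor C D ⥤ Hor A B where
  obj M := res f g M
  map {M N} α := ofCell
    ((isCartesian_cart f g N).lift (cart f g M ≫ toCell α) (𝟙 A) (𝟙 B)
      (by simp [L_comp, L_cart, L_toCell]) (by simp [R_comp, R_cart, R_toCell]))
    (IsCartesian.L_lift ..) (IsCartesian.R_lift ..)
  map_id M := toCell_injective <| (isCartesian_cart f g M).hom_ext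
    (by simp [IsCartesian.L_lift, L_id]) (by simp [IsCartesian.R_lift, R_id])
    (by simp [IsCartesian.fac])
  map_comp {M N P} α β := toCell_injective <| (isCartesian_cart f g P).hom_ext
    (by simp [IsCartesian.L_lift, L_comp]) (by simp [IsCartesian.R_lift, R_comp])
    (by
      simp only [toCell_ofCell, toCell_comp, IsCartesian.fac, Category.assoc]
      rw [← Category.assoc _ (cart f g N), IsCartesian.fac, Category.assoc])

lemma restriction_map_cart {A B C D : V} (f : A ⟶ C) (g : B ⟶ D) {M N : Hor C D} (α : M ⟶ N) :
    toCell ((restriction f g).map α) ≫ cart f g N = cart f g M ≫ toCell α :=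
  IsCartesian.fac ..

/-- The extension of scalars functor `f_! (-) g_!`. -/
@[reducible] noncomputable def extension {A B C D : V} (f : A ⟶ C) (g : B ⟶ D) : Hor A B ⥤ Hor C D where
  obj M := ext f g M
  map {M N} α := ofCell
    ((isCocartesian_cocart f g M).desc (toCell α ≫ cocart f g N) (𝟙 C) (𝟙 D)
      (by simp [L_comp, L_cocart, L_toCell]) (by simp [R_comp, R_cocart, R_toCell]))
    (IsCocartesian.L_desc ..) (IsCocartesian.R_desc ..)
  map_id M := toCell_injective <| (isCocartesian_cocart f g M).hom_ext
    (by simp [IsCocartesian.L_desc, L_id]) (by simp [IsCocartesian.R_desc, R_id])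
    (by simp [IsCocartesian.fac])
  map_comp {M N P} α β := toCell_injective <| (isCocartesian_cocart f g M).hom_ext
    (by simp [IsCocartesian.L_desc, L_comp]) (by simp [IsCocartesian.R_desc, R_comp])
    (by
      simp only [toCell_ofCell, toCell_comp, IsCocartesian.fac, Category.assoc]
      rw [← Category.assoc (cocart f g M), IsCocartesian.fac, Category.assoc, IsCocartesian.fac])

lemma cocart_extension_map {A B C D : V} (f : A ⟶ C) (g : B ⟶ D) {M N : Hor A B} (α : M ⟶ N) :
    cocart f g M ≫ toCell ((extension f g).map α) = toCell α ≫ cocart f g N :=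
  IsCocartesian.fac ..

/-- Extension of scalars on the left, `f_! (-)`. -/
noncomputable abbrev leftExt {A B : V} (f : A ⟶ B) (C : V) : Hor A C ⥤ Hor B C :=
  extension f (𝟙 C)

/-- Extension of scalars on the right, `(-) f_!`. -/
noncomputable abbrev rightExt {A B : V} (C : V) (f : A ⟶ B) : Hor C A ⥤ Hor C B :=
  extension (𝟙 C) f

/-- The globular 2-cell `M ⟶ f^* N g^*` corresponding to a 2-cell `M ⟶ N` over `(f, g)`. -/
noncomputable def fact {A B C D : V} {f : A ⟶ C} {g : B ⟶ D} {M : Hor A B} {N : Hor C D}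
    (γ : of M ⟶ of N) (hL : L γ = f) (hR : R γ = g) : M ⟶ res f g N :=
  ofCell ((isCartesian_cart f g N).lift γ (𝟙 A) (𝟙 B) (by simp [hL, L_cart])
    (by simp [hR, R_cart])) (IsCartesian.L_lift ..) (IsCartesian.R_lift ..)

lemma fact_cart {A B C D : V} {f : A ⟶ C} {g : B ⟶ D} {M : Hor A B} {N : Hor C D}
    (γ : of M ⟶ of N) (hL : L γ = f) (hR : R γ = g) :
    toCell (fact γ hL hR) ≫ cart f g N = γ :=
  IsCartesian.fac ..

lemma res_hom_ext {A B C D : V} {f : A ⟶ C} {g : B ⟶ D} {M : Hor A B} {N : Hor C D}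
    {α β : M ⟶ res f g N} (h : toCell α ≫ cart f g N = toCell β ≫ cart f g N) : α = β :=
  toCell_injective <| (isCartesian_cart f g N).hom_ext (by rw [L_toCell, L_toCell])
    (by rw [R_toCell, R_toCell]) h

lemma ext_hom_ext {A B C D : V} {f : A ⟶ C} {g : B ⟶ D} {M : Hor A B} {N : Hor C D}
    {α β : ext f g M ⟶ N} (h : cocart f g M ≫ toCell α = cocart f g M ≫ toCell β) : α = β :=
  toCell_injective <| (isCocartesian_cocart f g M).hom_ext (by rw [L_toCell, L_toCell])
    (by rw [R_toCell, R_toCell]) h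

/-- The adjunct `M ⟶ f^* N g^*` of a globular 2-cell `f_! M g_! ⟶ N`. -/
noncomputable def adjunct {A B C D : V} {f : A ⟶ C} {g : B ⟶ D} {M : Hor A B} {N : Hor C D}
    (α : ext f g M ⟶ N) : M ⟶ res f g N :=
  fact (cocart f g M ≫ toCell α) (by simp [L_comp, L_cocart, L_toCell])
    (by simp [R_comp, R_cocart, R_toCell])

lemma adjunct_cart {A B C D : V} {f : A ⟶ C} {g : B ⟶ D} {M : Hor A B} {N : Hor C D}
    (α : ext f g M ⟶ N) : toCell (adjunct α) ≫ cart f g N = cocart f g M ≫ toCell α :=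
  fact_cart _ _ _

/-- The adjunct `f_! M g_! ⟶ N` of a globular 2-cell `M ⟶ f^* N g^*`. -/
noncomputable def coadjunct {A B C D : V} {f : A ⟶ C} {g : B ⟶ D} {M : Hor A B} {N : Hor C D}
    (β : M ⟶ res f g N) : ext f g M ⟶ N :=
  ofCell ((isCocartesian_cocart f g M).desc (toCell β ≫ cart f g N) (𝟙 C) (𝟙 D)
    (by simp [L_comp, L_cocart, L_cart, L_toCell]) (by simp [R_comp, R_cocart, R_cart, R_toCell]))
    (IsCocartesian.L_desc ..) (IsCocartesian.R_desc ..)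

lemma cocart_coadjunct {A B C D : V} {f : A ⟶ C} {g : B ⟶ D} {M : Hor A B} {N : Hor C D}
    (β : M ⟶ res f g N) : cocart f g M ≫ toCell (coadjunct β) = toCell β ≫ cart f g N :=
  IsCocartesian.fac ..

/-- Extension of scalars is left adjoint to restriction of scalars. -/
noncomputable def extensionAdj {A B C D : V} (f : A ⟶ C) (g : B ⟶ D) :
    extension f g ⊣ restriction f g :=
  Adjunction.mkOfHomEquiv
    { homEquiv := fun _ _ =>
        { toFun := adjunct
          invFun := coadjunct
          left_inv := fun α => ext_hom_ext ((cocart_coadjunct _).trans (adjunct_cart α))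
          right_inv := fun β => res_hom_ext ((adjunct_cart _).trans (cocart_coadjunct β)) }
      homEquiv_naturality_left_symm := fun {M' M N} α β => ext_hom_ext (by
        have h : cocart f g M' ≫ toCell ((extension f g).map α ≫ coadjunct β) =
            toCell (α ≫ β) ≫ cart f g N := by
          rw [toCell_comp, toCell_comp, ← Category.assoc, cocart_extension_map, Category.assoc,
            cocart_coadjunct, Category.assoc]
        exact (cocart_coadjunct _).trans h.symm)
      homEquiv_naturality_right := fun {M N N'} α β => res_hom_ext (by
        have h : toCell (adjunct α ≫ (restriction f g).map β) ≫ cart f g N' =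
            cocart f g M ≫ toCell (α ≫ β) := by
          rw [toCell_comp, toCell_comp, Category.assoc, restriction_map_cart, ← Category.assoc,
            adjunct_cart, Category.assoc]
        exact (adjunct_cart _).trans h.symm) }

end Framed

/-! ## Abelian framed bicategories -/

/-- A framed bicategory is abelian if all local categories are abelian and horizontal composition
of globular 2-cells is additive in each variable. -/
class AbelianFramed (V : Type u) [Category.{v} V] [FramedBicategory.{w, z} V] where
  /-- the local categories are abelian -/
  [localAbelian : ∀ A B : V, Abelian (Hor A B)]
  hcompLeft_additive : ∀ {A B : V} (M : Hor A B) (C : V), (hcompLeft M C).Additive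
  hcompRight_additive : ∀ (A : V) {B C : V} (N : Hor B C), (hcompRight A N).Additive

attribute [instance, reducible] AbelianFramed.localAbelian

open AbelianFramed

/-- An abelian framed bicategory with initial coefficient `I` is module-like if it is locally
cocomplete, closed, all restriction functors are faithful and `U_I` is a compact projective
generator of the local category of 1-cells `I ⇸ I`. -/
structure IsModuleLike (V : Type u) [Category.{v} V] [FramedBicategory.{w, z} V]
    [AbelianFramed V]
    {I : V} (hI : IsInitial I) : Prop where
  locally_cocomplete : ∀ A B : V, HasColimits (Hor A B)
  closed_left : ∀ {A B : V} (M : Hor A B) (C : V), (hcompLeft M C).IsLeftAdjoint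
  closed_right : ∀ (A : V) {B C : V} (N : Hor B C), (hcompRight A N).IsLeftAdjoint
  faithful : ∀ {A B C D : V} (f : A ⟶ C) (g : B ⟶ D), (restriction f g).Faithful
  projective : Projective (U I)
  generator : (coyoneda.obj (Opposite.op (U I))).ReflectsIsomorphisms
  compact : PreservesFilteredColimits (coyoneda.obj (Opposite.op (U I)))

section AbelianFramed

variable {V : Type u} [Category.{v} V] [FramedBicategory.{w, z} V]
    [AbelianFramed V]

lemma restriction_additive {A B C D : V} (f : A ⟶ C) (g : B ⟶ D) :
    (restriction f g).Additive := by
  have := (extensionAdj f g).rightAdjoint_preservesLimits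
  exact Functor.additive_of_preserves_binary_products _

lemma pushCell_add {A B C D : V} {M : Hor A B} {N : Hor C D} {c : of M ⟶ of N}
    (hc : IsCocartesian c) (α α' : End M) :
    pushCell hc (α + α') = pushCell hc α + pushCell hc α' := by
  have := restriction_additive (L c) (R c)
  have key : ∀ (a : End M) (b : End N), (c ≫ toCell b = toCell a ≫ c) ↔
      fact c rfl rfl ≫ (restriction (L c) (R c)).map b = a ≫ fact c rfl rfl := by
    intro a b
    have h1 : toCell (fact c rfl rfl ≫ (restriction (L c) (R c)).map b) ≫ cart _ _ N =
        c ≫ toCell b := by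
      rw [toCell_comp, Category.assoc]
      erw [restriction_map_cart]
      rw [← Category.assoc]
      erw [fact_cart]
    have h2 : toCell (a ≫ fact c rfl rfl) ≫ cart _ _ N = toCell a ≫ c := by
      rw [toCell_comp, Category.assoc]
      erw [fact_cart]
    constructor
    · intro h
      exact res_hom_ext (h1.trans (h.trans h2.symm))
    · intro h
      rw [← h1, h, h2]
  refine (eq_pushCell hc _ _ ?_).symm
  rw [key, Functor.map_add, Preadditive.comp_add, Preadditive.add_comp,
    (key _ _).1 (comp_pushCell hc α), (key _ _).1 (comp_pushCell hc α')]

/-- A cocartesian 2-cell `c : M ⟶ N` induces a ring homomorphism `End M → End N`, which sends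
`α` to the unique `β` with `c ≫ β = α ≫ c`. -/
noncomputable def pushEnd {A B C D : V} {M : Hor A B} {N : Hor C D} {c : of M ⟶ of N}
    (hc : IsCocartesian c) : End M →+* End N :=
  RingHom.mk'
    { toFun := pushCell hc
      map_one' := (eq_pushCell hc _ _ (by
        erw [toCell_id, toCell_id, Category.comp_id, Category.id_comp])).symm
      map_mul' := fun α β => (eq_pushCell hc _ _ (by
        rw [End.mul_def, End.mul_def, toCell_comp, toCell_comp, ← Category.assoc, comp_pushCell,
          Category.assoc, comp_pushCell, Category.assoc])).symm }
    (pushCell_add hc)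

lemma comp_pushEnd {A B C D : V} {M : Hor A B} {N : Hor C D} {c : of M ⟶ of N}
    (hc : IsCocartesian c) (α : End M) : c ≫ toCell (pushEnd hc α) = toCell α ≫ c :=
  comp_pushCell hc α

lemma eq_pushEnd {A B C D : V} {M : Hor A B} {N : Hor C D} {c : of M ⟶ of N}
    (hc : IsCocartesian c) (α : End M) (β : End N) (h : c ≫ toCell β = toCell α ≫ c) :
    β = pushEnd hc α :=
  eq_pushCell hc α β h

/-- The ring homomorphism `End M → End (f_! M g_!)` induced by the extension functor. -/
noncomputable def extEnd {A B C D : V} (f : A ⟶ C) (g : B ⟶ D) (M : Hor A B) :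
    End M →+* End ((extension f g).obj M) where
  toFun α := (extension f g).map α
  map_one' := (extension f g).map_id M
  map_mul' α β := (extension f g).map_comp β α
  map_zero' := by
    have := restriction_additive f g
    have := (extensionAdj f g).left_adjoint_additive
    exact (extension f g).map_zero M M
  map_add' α β := by
    have := restriction_additive f g
    have := (extensionAdj f g).left_adjoint_additive
    exact (extension f g).map_add

lemma extEnd_eq_pushEnd {A B C D : V} (f : A ⟶ C) (g : B ⟶ D) (M : Hor A B) (α : End M) :
    extEnd f g M α = pushEnd (isCocartesian_cocart f g M) α :=
  eq_pushEnd _ _ _ (cocart_extension_map f g α)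

lemma pushEnd_pushEnd {A B A' B' A'' B'' : V} {M : Hor A B} {N : Hor A' B'} {P : Hor A'' B''}
    {c : of M ⟶ of N} {d : of N ⟶ of P} {e : of M ⟶ of P} (hc : IsCocartesian c)
    (hd : IsCocartesian d) (he : IsCocartesian e) (h : c ≫ d = e) (α : End M) :
    pushEnd hd (pushEnd hc α) = pushEnd he α := by
  subst h
  refine eq_pushEnd he _ _ ?_
  rw [Category.assoc, comp_pushEnd, ← Category.assoc, comp_pushEnd, Category.assoc]

lemma pushEnd_id {A B : V} {M : Hor A B} {c : of M ⟶ of M} (hc : IsCocartesian c)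
    (h : c = 𝟙 (of M)) (α : End M) : pushEnd hc α = α := by
  subst h
  exact (eq_pushEnd hc _ _ (by rw [Category.id_comp, Category.comp_id])).symm

/-! ### The commutative ring `End U_A` and the algebras `End (f_! U_A)`, `End (U_A f_!)` -/

/-- `End U_A` is a commutative ring. -/
noncomputable instance endUnitCommRing (A : V) : CommRing (End (U A)) :=
  { (inferInstance : Ring (End (U A))) with
    mul_comm := fun p q => toCell_injective (by
      have h := actR_comm (toCell p) (L_toCell p) (toCell q) (R_toCell q)
      rw [actR_unit] at h
      exact h) }

/-- The image of `End U_A → End (f_! U_A)` is central. -/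
lemma leftExt_central {A B : V} (f : A ⟶ B) (p : End (U A))
    (α : End ((leftExt f A).obj (U A))) :
    extEnd f (𝟙 A) (U A) p * α = α * extEnd f (𝟙 A) (U A) p := by
  have h : toCell (extEnd f (𝟙 A) (U A) p) = actR _ (toCell p) (L_toCell p) := by
    refine (isCocartesian_cocart f (𝟙 A) (U A)).hom_ext ((L_toCell _).trans (L_actR _ _ _).symm)
      ((R_toCell _).trans (R_actR _ _ _ (R_toCell p)).symm) ?_
    rw [actR_comm _ _ _ (R_cocart _ _ _), actR_unit]
    exact cocart_extension_map _ _ _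
  refine toCell_injective ?_
  rw [End.mul_def, End.mul_def, toCell_comp, toCell_comp, h, actR_comm _ _ _ (R_toCell α)]

/-- The image of `End U_A → End (U_A f_!)` is central. -/
lemma rightExt_central {A B : V} (f : A ⟶ B) (p : End (U A))
    (α : End ((rightExt A f).obj (U A))) :
    extEnd (𝟙 A) f (U A) p * α = α * extEnd (𝟙 A) f (U A) p := by
  have h : toCell (extEnd (𝟙 A) f (U A) p) = actL _ (toCell p) (R_toCell p) := by
    refine (isCocartesian_cocart (𝟙 A) f (U A)).hom_ext
      ((L_toCell _).trans (L_actL _ _ _ (L_toCell p)).symm)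
      ((R_toCell _).trans (R_actL _ _ _).symm) ?_
    rw [actL_comm _ _ _ (L_cocart _ _ _), actL_unit]
    exact cocart_extension_map _ _ _
  refine toCell_injective ?_
  rw [End.mul_def, End.mul_def, toCell_comp, toCell_comp, h, actL_comm _ _ _ (L_toCell α)]

/-- The ring `End (f_! U_A)`. -/
def LeftEnd {A B : V} (f : A ⟶ B) : Type z := End ((leftExt f A).obj (U A))

/-- The ring `End (U_A f_!)`. -/
def RightEnd {A B : V} (f : A ⟶ B) : Type z := End ((rightExt A f).obj (U A))

noncomputable instance {A B : V} (f : A ⟶ B) : Ring (LeftEnd f) :=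
  inferInstanceAs (Ring (End ((leftExt f A).obj (U A))))

noncomputable instance {A B : V} (f : A ⟶ B) : Ring (RightEnd f) :=
  inferInstanceAs (Ring (End ((rightExt A f).obj (U A))))

/-- The `End U_A`-algebra structure on `End (f_! U_A)` given by `p ↦ f_! p`. -/
noncomputable instance {A B : V} (f : A ⟶ B) : Algebra (End (U A)) (LeftEnd f) :=
  RingHom.toAlgebra' (S := LeftEnd f) (extEnd f (𝟙 A) (U A)) (leftExt_central f)

/-- The `End U_A`-algebra structure on `End (U_A f_!)` given by `p ↦ p f_!`. -/
noncomputable instance {A B : V} (f : A ⟶ B) : Algebra (End (U A)) (RightEnd f) :=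
  RingHom.toAlgebra' (S := RightEnd f) (extEnd (𝟙 A) f (U A)) (rightExt_central f)

/-! ### The functors `R(-, I)` and `R(I, -)` -/

section Initial

variable {I : V} (hI : IsInitial I)

/-- For `f : A ⟶ B`, the 2-cell `f̂ : ι_{A!} U_I ⟶ ι_{B!} U_I` over `(f, id_I)` that is the
factorization of the cocartesian 2-cell `U_I ⟶ ι_{B!} U_I` through `U_I ⟶ ι_{A!} U_I`. -/
noncomputable def leftHat {A B : V} (f : A ⟶ B) :
    of (ext (hI.to A) (𝟙 I) (U I)) ⟶ of (ext (hI.to B) (𝟙 I) (U I)) :=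
  (isCocartesian_cocart (hI.to A) (𝟙 I) (U I)).desc (cocart (hI.to B) (𝟙 I) (U I)) f (𝟙 I)
    (hI.hom_ext _ _) (by simp [R_cocart])

lemma cocart_leftHat {A B : V} (f : A ⟶ B) :
    cocart (hI.to A) (𝟙 I) (U I) ≫ leftHat hI f = cocart (hI.to B) (𝟙 I) (U I) :=
  IsCocartesian.fac ..

lemma isCocartesian_leftHat {A B : V} (f : A ⟶ B) : IsCocartesian (leftHat hI f) :=
  (isCocartesian_cocart (hI.to A) (𝟙 I) (U I)).of_comp
    (by rw [cocart_leftHat]; exact isCocartesian_cocart _ _ _)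

/-- For `f : A ⟶ B`, the 2-cell `f̂ : U_I ι_{A!} ⟶ U_I ι_{B!}` over `(id_I, f)` that is the
factorization of the cocartesian 2-cell `U_I ⟶ U_I ι_{B!}` through `U_I ⟶ U_I ι_{A!}`. -/
noncomputable def rightHat {A B : V} (f : A ⟶ B) :
    of (ext (𝟙 I) (hI.to A) (U I)) ⟶ of (ext (𝟙 I) (hI.to B) (U I)) :=
  (isCocartesian_cocart (𝟙 I) (hI.to A) (U I)).desc (cocart (𝟙 I) (hI.to B) (U I)) (𝟙 I) f
    (by simp [L_cocart]) (hI.hom_ext _ _)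

lemma cocart_rightHat {A B : V} (f : A ⟶ B) :
    cocart (𝟙 I) (hI.to A) (U I) ≫ rightHat hI f = cocart (𝟙 I) (hI.to B) (U I) :=
  IsCocartesian.fac ..

lemma isCocartesian_rightHat {A B : V} (f : A ⟶ B) : IsCocartesian (rightHat hI f) :=
  (isCocartesian_cocart (𝟙 I) (hI.to A) (U I)).of_comp
    (by rw [cocart_rightHat]; exact isCocartesian_cocart _ _ _)

lemma leftHat_id (A : V) : leftHat hI (𝟙 A) = 𝟙 _ :=
  (isCocartesian_cocart (hI.to A) (𝟙 I) (U I)).hom_ext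
    ((IsCocartesian.L_desc ..).trans (L_id (of _)).symm) ((IsCocartesian.R_desc ..).trans (R_id (of _)).symm)
    (by rw [cocart_leftHat, Category.comp_id])

lemma leftHat_comp {A B C : V} (f : A ⟶ B) (g : B ⟶ C) :
    leftHat hI (f ≫ g) = leftHat hI f ≫ leftHat hI g :=
  (isCocartesian_cocart (hI.to A) (𝟙 I) (U I)).hom_ext
    (by simp [leftHat, L_comp, IsCocartesian.L_desc])
    (by simp [leftHat, R_comp, IsCocartesian.R_desc])
    (by rw [cocart_leftHat, ← Category.assoc, cocart_leftHat, cocart_leftHat])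

lemma rightHat_id (A : V) : rightHat hI (𝟙 A) = 𝟙 _ :=
  (isCocartesian_cocart (𝟙 I) (hI.to A) (U I)).hom_ext
    ((IsCocartesian.L_desc ..).trans (L_id (of _)).symm) ((IsCocartesian.R_desc ..).trans (R_id (of _)).symm)
    (by rw [cocart_rightHat, Category.comp_id])

lemma rightHat_comp {A B C : V} (f : A ⟶ B) (g : B ⟶ C) :
    rightHat hI (f ≫ g) = rightHat hI f ≫ rightHat hI g :=
  (isCocartesian_cocart (𝟙 I) (hI.to A) (U I)).hom_ext
    (by simp [rightHat, L_comp, IsCocartesian.L_desc])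
    (by simp [rightHat, R_comp, IsCocartesian.R_desc])
    (by rw [cocart_rightHat, ← Category.assoc, cocart_rightHat, cocart_rightHat])

/-- The `End U_I`-algebra homomorphism `R(f, I) : End (ι_{A!} U_I) → End (ι_{B!} U_I)`, sending
`α` to the unique `β` with `β ∘ f̂ = f̂ ∘ α`. -/
noncomputable def leftAlgMap {A B : V} (f : A ⟶ B) :
    LeftEnd (hI.to A) →ₐ[End (U I)] LeftEnd (hI.to B) :=
  { (pushEnd (isCocartesian_leftHat hI f) : LeftEnd (hI.to A) →+* LeftEnd (hI.to B)) with
    commutes' := fun p => by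
      refine (congrArg (pushEnd (isCocartesian_leftHat hI f))
        (extEnd_eq_pushEnd (hI.to A) (𝟙 I) (U I) p)).trans
          (Eq.trans ?_ (extEnd_eq_pushEnd (hI.to B) (𝟙 I) (U I) p).symm)
      exact pushEnd_pushEnd _ _ _ (cocart_leftHat hI f) p }

/-- The `End U_I`-algebra homomorphism `R(I, f) : End (U_I ι_{A!}) → End (U_I ι_{B!})`, sending
`α` to the unique `β` with `β ∘ f̂ = f̂ ∘ α`. -/
noncomputable def rightAlgMap {A B : V} (f : A ⟶ B) :
    RightEnd (hI.to A) →ₐ[End (U I)] RightEnd (hI.to B) :=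
  { (pushEnd (isCocartesian_rightHat hI f) : RightEnd (hI.to A) →+* RightEnd (hI.to B)) with
    commutes' := fun p => by
      refine (congrArg (pushEnd (isCocartesian_rightHat hI f))
        (extEnd_eq_pushEnd (𝟙 I) (hI.to A) (U I) p)).trans
          (Eq.trans ?_ (extEnd_eq_pushEnd (𝟙 I) (hI.to B) (U I) p).symm)
      exact pushEnd_pushEnd _ _ _ (cocart_rightHat hI f) p }

/-- The functor `R(-, I)` from the vertical category to `End U_I`-algebras, sending `A` to
`End (ι_{A!} U_I)`. -/
noncomputable def leftR : V ⥤ AlgCat.{z} (End (U I)) where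
  obj A := AlgCat.of _ (LeftEnd (hI.to A))
  map f := AlgCat.ofHom (leftAlgMap hI f)
  map_id A := by
    ext α
    exact pushEnd_id (isCocartesian_leftHat hI (𝟙 A)) (leftHat_id hI A) α
  map_comp f g := by
    ext α
    exact (pushEnd_pushEnd (isCocartesian_leftHat hI f) (isCocartesian_leftHat hI g)
      (isCocartesian_leftHat hI (f ≫ g)) (leftHat_comp hI f g).symm α).symm

/-- The functor `R(I, -)` from the vertical category to `End U_I`-algebras, sending `A` to
`End (U_I ι_{A!})`. -/
noncomputable def rightR : V ⥤ AlgCat.{z} (End (U I)) where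
  obj A := AlgCat.of _ (RightEnd (hI.to A))
  map f := AlgCat.ofHom (rightAlgMap hI f)
  map_id A := by
    ext α
    exact pushEnd_id (isCocartesian_rightHat hI (𝟙 A)) (rightHat_id hI A) α
  map_comp f g := by
    ext α
    exact (pushEnd_pushEnd (isCocartesian_rightHat hI f) (isCocartesian_rightHat hI g)
      (isCocartesian_rightHat hI (f ≫ g)) (rightHat_comp hI f g).symm α).symm

end Initial

end AbelianFramed

/-- The functor sending an algebra to its opposite algebra. -/
def algOp (k : Type z) [CommRing k] : AlgCat.{z} k ⥤ AlgCat.{z} k where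
  obj S := AlgCat.of k Sᵐᵒᵖ
  map φ := AlgCat.ofHom (AlgHom.op φ.hom)

end FramedBicat

namespace FramedBicat

open OneCell (of)
open DoubleCategory FramedBicategory AbelianFramed

section Double

variable {V : Type u} [Category.{v} V] [DoubleCategory.{w, z} V]

/-- The interchange law, as a rewrite rule for vertical composites of horizontal composites. -/
lemma hmap_comp_hmap {A B C A' B' C' A'' B'' C'' : V} {M : Hor A B} {N : Hor B C}
    {M' : Hor A' B'} {N' : Hor B' C'} {M'' : Hor A'' B''} {N'' : Hor B'' C''}
    (α : of M ⟶ of M') (β : of N ⟶ of N') (h : R α = L β)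
    (α' : of M' ⟶ of M'') (β' : of N' ⟶ of N'') (h' : R α' = L β') :
    hmap α β h ≫ hmap α' β' h' =
      hmap (α ≫ α') (β ≫ β') (by rw [R_comp, L_comp, h, h']) :=
  (hmap_comp α β h α' β' h' _).symm

/-- Naturality of the right unit isomorphism over an arbitrary vertical arrow. -/
lemma hmap_Umap_runit {A B A' B' : V} {M : Hor A B} {M' : Hor A' B'} (α : of M ⟶ of M')
    {f : B ⟶ B'} (hf : R α = f) :
    hmap α (Umap f) (hf.trans (L_Umap f).symm) ≫ (runit M').hom = (runit M).hom ≫ α := by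
  subst hf
  exact runit_naturality α

/-- Naturality of the left unit isomorphism over an arbitrary vertical arrow. -/
lemma hmap_Umap_lunit {A B A' B' : V} {M : Hor A B} {M' : Hor A' B'} (α : of M ⟶ of M')
    {f : A ⟶ A'} (hf : L α = f) :
    hmap (Umap f) α ((R_Umap f).trans hf.symm) ≫ (lunit M').hom = (lunit M).hom ≫ α := by
  subst hf
  exact lunit_naturality α

lemma L_runit_inv {A B : V} (M : Hor A B) : L (runit M).inv = 𝟙 A :=
  L_inv_eq (runit M) rfl rfl (L_runit M)

lemma R_runit_inv {A B : V} (M : Hor A B) : R (runit M).inv = 𝟙 B :=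
  R_inv_eq (runit M) rfl rfl (R_runit M)

lemma L_lunit_inv {A B : V} (M : Hor A B) : L (lunit M).inv = 𝟙 A :=
  L_inv_eq (lunit M) rfl rfl (L_lunit M)

lemma R_lunit_inv {A B : V} (M : Hor A B) : R (lunit M).inv = 𝟙 B :=
  R_inv_eq (lunit M) rfl rfl (R_lunit M)

/-- The two whiskerings of a globular endomorphism of a unit 1-cell agree. -/
lemma hmap_id_unit_eq {A : V} (p : of (U A) ⟶ of (U A)) (hL : L p = 𝟙 A) (hR : R p = 𝟙 A) :
    hmap (𝟙 (of (U A))) p ((R_id (of (U A))).trans hL.symm) =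
      hmap p (𝟙 (of (U A))) (hR.trans (L_id (of (U A))).symm) := by
  have h := actR_unit p hL
  rw [actR, Iso.inv_comp_eq, ← runit_nat p hR] at h
  exact (cancel_mono _).1 h

/-- Passing from the middle unit on the right to the middle unit on the left: if `x` and `y` are
the composites of `u`, `m` and of `m`, `v` along the middle unit, then `u ⊙ y = x ⊙ v`. -/
lemma hmap_eq_of_middle_unit {A B C A' B' C' : V} {M : Hor A B} {N : Hor B C} {M' : Hor A' B'}
    {N' : Hor B' C'} {u x : of M ⟶ of M'} {v y : of N ⟶ of N'} {m : of (U B) ⟶ of (U B')}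
    (hum : R u = L m) (hmv : R m = L v) (huy : R u = L y) (hxv : R x = L v)
    (hx : hmap u m hum ≫ (runit M').hom = (runit M).hom ≫ x)
    (hy : hmap m v hmv ≫ (lunit N').hom = (lunit N).hom ≫ y) :
    hmap u y huy = hmap x v hxv := by
  have h1 : hmap (𝟙 (of M)) (lunit N).hom ((R_id (of M)).trans (L_lunit N).symm) ≫
      hmap u y huy = hmap u (hmap m v hmv) (hum.trans (L_hmap m v hmv).symm) ≫
        hmap (𝟙 (of M')) (lunit N').hom ((R_id (of M')).trans (L_lunit N').symm) := by
    rw [hmap_comp_hmap, hmap_comp_hmap]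
    exact hmap_congr (by simp) hy.symm _ _
  have h2 : hmap (runit M).hom (𝟙 (of N)) ((R_runit M).trans (L_id (of N)).symm) ≫
      hmap x v hxv = hmap (hmap u m hum) v ((R_hmap u m hum).trans hmv) ≫
        hmap (runit M').hom (𝟙 (of N')) ((R_runit M').trans (L_id (of N')).symm) := by
    rw [hmap_comp_hmap, hmap_comp_hmap]
    exact hmap_congr hx.symm (by simp) _ _
  have : IsIso (hmap (𝟙 (of M)) (lunit N).hom ((R_id (of M)).trans (L_lunit N).symm)) := by
    refine ⟨hmap (𝟙 (of M)) (lunit N).inv ((R_id (of M)).trans (L_lunit_inv N).symm), ?_, ?_⟩ <;>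
    · rw [hmap_comp_hmap, ← hmap_id]
      exact hmap_congr (by simp) (by simp) _ _
  rw [← cancel_epi (hmap (𝟙 (of M)) (lunit N).hom ((R_id (of M)).trans (L_lunit N).symm)), h1,
    ← triangle, ← triangle, Category.assoc, h2, ← Category.assoc, ← Category.assoc,
    assoc_naturality u m v hum hmv]

end Double

section Framed

variable {V : Type u} [Category.{v} V] [FramedBicategory.{w, z} V]

/-- The chosen cocartesian 2-cell `U_A ⟶ f_! U_A`. -/
abbrev leftUnitCell {A B : V} (f : A ⟶ B) : of (U A) ⟶ of (ext f (𝟙 A) (U A)) :=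
  cocart f (𝟙 A) (U A)

/-- The chosen cocartesian 2-cell `U_A ⟶ U_A f_!`. -/
abbrev rightUnitCell {A B : V} (f : A ⟶ B) : of (U A) ⟶ of (ext (𝟙 A) f (U A)) :=
  cocart (𝟙 A) f (U A)

/-- The 2-cell `f_! U_A ⟶ U_B` over `(id, f)` through which `U_f` factors. -/
noncomputable def leftCounitCell {A B : V} (f : A ⟶ B) :
    of (ext f (𝟙 A) (U A)) ⟶ of (U B) :=
  (isCocartesian_cocart f (𝟙 A) (U A)).desc (Umap f) (𝟙 B) f
    (by simp [L_Umap, L_cocart]) (by simp [R_Umap, R_cocart])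

/-- The 2-cell `U_A f_! ⟶ U_B` over `(f, id)` through which `U_f` factors. -/
noncomputable def rightCounitCell {A B : V} (f : A ⟶ B) :
    of (ext (𝟙 A) f (U A)) ⟶ of (U B) :=
  (isCocartesian_cocart (𝟙 A) f (U A)).desc (Umap f) f (𝟙 B)
    (by simp [L_Umap, L_cocart]) (by simp [R_Umap, R_cocart])

variable {A B : V} (f : A ⟶ B)

lemma L_leftCounitCell : L (leftCounitCell f) = 𝟙 B := IsCocartesian.L_desc ..

lemma R_leftCounitCell : R (leftCounitCell f) = f := IsCocartesian.R_desc ..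

lemma leftUnitCell_counit : leftUnitCell f ≫ leftCounitCell f = Umap f := IsCocartesian.fac ..

lemma L_rightCounitCell : L (rightCounitCell f) = f := IsCocartesian.L_desc ..

lemma R_rightCounitCell : R (rightCounitCell f) = 𝟙 B := IsCocartesian.R_desc ..

lemma rightUnitCell_counit : rightUnitCell f ≫ rightCounitCell f = Umap f := IsCocartesian.fac ..

/-- `α` and `β` are mates under the duality between `f_! U_A` and `U_A f_!`, whose coevaluation
is `U_A ≅ U_A ⊙ U_A ⟶ U_A f_! ⊙ f_! U_A`. -/
def IsMate (α : End (ext f (𝟙 A) (U A))) (β : End (ext (𝟙 A) f (U A))) : Prop :=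
  hmap (rightUnitCell f) (leftUnitCell f ≫ toCell α)
      (by simp [L_comp, R_cocart, L_cocart, L_toCell]) =
    hmap (rightUnitCell f ≫ toCell β) (leftUnitCell f)
      (by simp [R_comp, R_cocart, L_cocart, R_toCell])

/-- The 2-cell `U_A ⟶ U_B` over `(f, f)` determined by an endomorphism of `f_! U_A`. -/
noncomputable def leftTranspose (α : End (ext f (𝟙 A) (U A))) : of (U A) ⟶ of (U B) :=
  leftUnitCell f ≫ toCell α ≫ leftCounitCell f

/-- The 2-cell `U_A ⟶ U_B` over `(f, f)` determined by an endomorphism of `U_A f_!`. -/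
noncomputable def rightTranspose (β : End (ext (𝟙 A) f (U A))) : of (U A) ⟶ of (U B) :=
  rightUnitCell f ≫ toCell β ≫ rightCounitCell f

lemma L_leftTranspose (α : End (ext f (𝟙 A) (U A))) : L (leftTranspose f α) = f := by
  simp [leftTranspose, L_comp, L_cocart, L_toCell, L_leftCounitCell]

lemma R_leftTranspose (α : End (ext f (𝟙 A) (U A))) : R (leftTranspose f α) = f := by
  simp [leftTranspose, R_comp, R_cocart, R_toCell, R_leftCounitCell]

lemma L_rightTranspose (β : End (ext (𝟙 A) f (U A))) : L (rightTranspose f β) = f := by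
  simp [rightTranspose, L_comp, L_cocart, L_toCell, L_rightCounitCell]

lemma R_rightTranspose (β : End (ext (𝟙 A) f (U A))) : R (rightTranspose f β) = f := by
  simp [rightTranspose, R_comp, R_cocart, R_toCell, R_rightCounitCell]

variable {f}

lemma IsMate.runit_comp {α : End (ext f (𝟙 A) (U A))} {β : End (ext (𝟙 A) f (U A))}
    (h : IsMate f α β) :
    hmap (rightUnitCell f) (leftTranspose f α) ((R_cocart _ _ _).trans (L_leftTranspose f α).symm) ≫
      (runit _).hom = (runit (U A)).hom ≫ rightUnitCell f ≫ toCell β := by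
  have h' := congrArg (· ≫ hmap (𝟙 _) (leftCounitCell f)
    ((R_id _).trans (L_leftCounitCell f).symm)) h
  simp only [hmap_comp_hmap] at h'
  rw [← hmap_Umap_runit (rightUnitCell f ≫ toCell β) (f := f)
    (by simp [R_comp, R_cocart, R_toCell])]
  congr 1
  refine Eq.trans (hmap_congr ?_ ?_ _ _) (h'.trans (hmap_congr ?_ ?_ _ _))
  · simp
  · simp [leftTranspose]
  · simp
  · exact leftUnitCell_counit f

lemma IsMate.lunit_comp {α : End (ext f (𝟙 A) (U A))} {β : End (ext (𝟙 A) f (U A))}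
    (h : IsMate f α β) :
    hmap (rightTranspose f β) (leftUnitCell f) ((R_rightTranspose f β).trans (L_cocart _ _ _).symm) ≫
      (lunit _).hom = (lunit (U A)).hom ≫ leftUnitCell f ≫ toCell α := by
  have h' := congrArg (· ≫ hmap (rightCounitCell f) (𝟙 _)
    ((R_rightCounitCell f).trans (L_id (of _)).symm)) h.symm
  simp only [hmap_comp_hmap] at h'
  rw [← hmap_Umap_lunit (leftUnitCell f ≫ toCell α) (f := f)
    (by simp [L_comp, L_cocart, L_toCell])]
  congr 1
  refine Eq.trans (hmap_congr ?_ ?_ _ _) (h'.trans (hmap_congr ?_ ?_ _ _))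
  · simp [rightTranspose]
  · simp
  · exact rightUnitCell_counit f
  · simp

lemma IsMate.right_unique {α : End (ext f (𝟙 A) (U A))} {β β' : End (ext (𝟙 A) f (U A))}
    (h : IsMate f α β) (h' : IsMate f α β') : β = β' :=
  ext_hom_ext ((cancel_epi (runit (U A)).hom).1 (h.runit_comp.symm.trans h'.runit_comp))

lemma IsMate.left_unique {α α' : End (ext f (𝟙 A) (U A))} {β : End (ext (𝟙 A) f (U A))}
    (h : IsMate f α β) (h' : IsMate f α' β) : α = α' :=
  ext_hom_ext ((cancel_epi (lunit (U A)).hom).1 (h.lunit_comp.symm.trans h'.lunit_comp))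

lemma IsMate.mul {α α' : End (ext f (𝟙 A) (U A))} {β β' : End (ext (𝟙 A) f (U A))}
    (h : IsMate f α β) (h' : IsMate f α' β') : IsMate f (α * α') (β' * β) := by
  have h1 := congrArg (· ≫ hmap (𝟙 _) (toCell α) ((R_id _).trans (L_toCell α).symm)) h'
  have h2 := congrArg (· ≫ hmap (toCell β') (𝟙 _) ((R_toCell β').trans (L_id (of _)).symm)) h
  simp only [hmap_comp_hmap] at h1 h2
  refine Eq.trans (hmap_congr ?_ ?_ _ _) (h1.trans (Eq.trans (hmap_congr ?_ ?_ _ _)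
    (h2.trans (hmap_congr ?_ ?_ _ _))))
  all_goals simp [End.mul_def]

/-- The coevaluation `U_A ⊙ U_A ⟶ U_A f_! ⊙ f_! U_A`. -/
noncomputable def coev (f : A ⟶ B) :
    hcomp (U A) (U A) ⟶ hcomp (ext (𝟙 A) f (U A)) (ext f (𝟙 A) (U A)) :=
  ofCell (hmap (rightUnitCell f) (leftUnitCell f) ((R_cocart _ _ _).trans (L_cocart _ _ _).symm))
    ((L_hmap _ _ _).trans (L_cocart _ _ _)) ((R_hmap _ _ _).trans (R_cocart _ _ _))

lemma isMate_iff_coev {α : End (ext f (𝟙 A) (U A))} {β : End (ext (𝟙 A) f (U A))} :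
    IsMate f α β ↔ coev f ≫ (hcompLeft (ext (𝟙 A) f (U A)) A).map α =
      coev f ≫ (hcompRight A (ext f (𝟙 A) (U A))).map β := by
  have h1 : toCell (coev f ≫ (hcompLeft (ext (𝟙 A) f (U A)) A).map α) =
      hmap (rightUnitCell f) (leftUnitCell f ≫ toCell α)
        (by simp [L_comp, R_cocart, L_cocart, L_toCell]) :=
    (hmap_comp_hmap _ _ _ _ _ _).trans (hmap_congr (Category.comp_id _) rfl _ _)
  have h2 : toCell (coev f ≫ (hcompRight A (ext f (𝟙 A) (U A))).map β) =
      hmap (rightUnitCell f ≫ toCell β) (leftUnitCell f)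
        (by simp [R_comp, R_cocart, L_cocart, R_toCell]) :=
    (hmap_comp_hmap _ _ _ _ _ _).trans (hmap_congr rfl (Category.comp_id _) _ _)
  exact ⟨fun h => toCell_injective (h1.trans (h.trans h2.symm)),
    fun h => h1.symm.trans ((congrArg toCell h).trans h2)⟩

end Framed

section AbelianFramed

variable {V : Type u} [Category.{v} V] [FramedBicategory.{w, z} V] [AbelianFramed V]
  {A B : V} {f : A ⟶ B}

lemma IsMate.add {α α' : End (ext f (𝟙 A) (U A))} {β β' : End (ext (𝟙 A) f (U A))}
    (h : IsMate f α β) (h' : IsMate f α' β') : IsMate f (α + α') (β + β') := by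
  have := hcompLeft_additive (ext (𝟙 A) f (U A)) A
  have := hcompRight_additive A (ext f (𝟙 A) (U A))
  rw [isMate_iff_coev] at h h' ⊢
  have hl := (congrArg (coev f ≫ ·) ((hcompLeft (ext (𝟙 A) f (U A)) A).map_add (f := α)
    (g := α'))).trans (Preadditive.comp_add _ _ _ (coev f) _ _)
  have hr := (congrArg (coev f ≫ ·) ((hcompRight A (ext f (𝟙 A) (U A))).map_add (f := β)
    (g := β'))).trans (Preadditive.comp_add _ _ _ (coev f) _ _)
  exact hl.trans ((congrArg₂ (· + ·) h h').trans hr.symm)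

lemma IsMate.extEnd (p : End (U A)) :
    IsMate f (extEnd f (𝟙 A) (U A) p) (extEnd (𝟙 A) f (U A) p) := by
  have h1 : leftUnitCell f ≫ toCell (FramedBicat.extEnd f (𝟙 A) (U A) p) =
      toCell p ≫ leftUnitCell f := cocart_extension_map f (𝟙 A) p
  have h2 : rightUnitCell f ≫ toCell (FramedBicat.extEnd (𝟙 A) f (U A) p) =
      toCell p ≫ rightUnitCell f := cocart_extension_map (𝟙 A) f p
  have h3 := congrArg (· ≫ toCell (coev f)) (hmap_id_unit_eq (toCell p) (L_toCell p) (R_toCell p))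
  simp only [coev, toCell_ofCell, hmap_comp_hmap] at h3
  exact (hmap_congr (Category.id_comp _).symm h1 _ _).trans
    (h3.trans (hmap_congr h2.symm (Category.id_comp _) _ _))

lemma leftTranspose_hmap (α : End (ext f (𝟙 A) (U A))) :
    hmap (leftTranspose f α) (leftUnitCell f)
        ((R_leftTranspose f α).trans (L_cocart _ _ _).symm) ≫ (lunit _).hom =
      (lunit (U A)).hom ≫ leftUnitCell f ≫ toCell α := by
  let κ : End (ext f (𝟙 A) (U A)) := ofCell ((runit _).inv ≫
      hmap (leftCounitCell f) (leftUnitCell f)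
        ((R_leftCounitCell f).trans (L_cocart _ _ _).symm) ≫ (lunit _).hom)
    (by simp [L_comp, L_hmap, L_runit_inv, L_lunit, L_leftCounitCell])
    (by simp [R_comp, R_hmap, R_runit_inv, R_lunit, R_cocart])
  let p : End (U A) := ofCell ((runit (U A)).inv ≫ (lunit (U A)).hom)
    (by simp [L_comp, L_runit_inv, L_lunit]) (by simp [R_comp, R_runit_inv, R_lunit])
  have hκ (γ : of (U A) ⟶ of (ext f (𝟙 A) (U A))) (hγ : R γ = 𝟙 A) :
      hmap (γ ≫ leftCounitCell f) (leftUnitCell f)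
        (by simp [R_comp, hγ, R_leftCounitCell, L_cocart]) ≫ (lunit _).hom =
      (runit (U A)).hom ≫ γ ≫ toCell κ := by
    have : (runit (U A)).hom ≫ γ ≫ toCell κ = ((runit (U A)).hom ≫ γ) ≫ toCell κ := by simp
    rw [this, ← runit_nat γ hγ, toCell_ofCell, Category.assoc, Iso.hom_inv_id_assoc,
      ← Category.assoc, hmap_comp_hmap]
    congr 1
    exact hmap_congr rfl (by simp) _ _
  have hp : κ = extEnd f (𝟙 A) (U A) p := by
    refine ext_hom_ext ((cancel_epi (runit (U A)).hom).1 ?_)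
    have e : cocart f (𝟙 A) (U A) ≫ toCell (extEnd f (𝟙 A) (U A) p) =
      toCell p ≫ leftUnitCell f := cocart_extension_map f (𝟙 A) p
    rw [e, ← hκ _ (R_cocart _ _ _)]
    have e2 : (runit (U A)).hom ≫ toCell p ≫ leftUnitCell f =
        (lunit (U A)).hom ≫ leftUnitCell f := by simp [p]
    rw [e2, ← hmap_Umap_lunit (leftUnitCell f) (L_cocart _ _ _)]
    congr 1
    exact hmap_congr (leftUnitCell_counit f) rfl _ _
  have hc : toCell α ≫ toCell κ = toCell κ ≫ toCell α := by
    rw [hp]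
    exact congrArg toCell (leftExt_central f p α)
  have e : leftUnitCell f ≫ toCell (extEnd f (𝟙 A) (U A) p) =
      toCell p ≫ leftUnitCell f := cocart_extension_map f (𝟙 A) p
  refine (congrArg (· ≫ (lunit _).hom) (hmap_congr (Category.assoc _ _ _).symm rfl _ _)).trans
    ((hκ (leftUnitCell f ≫ toCell α) (by simp [R_comp, R_cocart, R_toCell])).trans ?_)
  rw [Category.assoc, hc, hp, ← Category.assoc (leftUnitCell f), e]
  simp [p]

lemma rightTranspose_hmap (β : End (ext (𝟙 A) f (U A))) :
    hmap (rightUnitCell f) (rightTranspose f β)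
        ((R_cocart _ _ _).trans (L_rightTranspose f β).symm) ≫ (runit _).hom =
      (runit (U A)).hom ≫ rightUnitCell f ≫ toCell β := by
  let κ : End (ext (𝟙 A) f (U A)) := ofCell ((lunit _).inv ≫
      hmap (rightUnitCell f) (rightCounitCell f)
        ((R_cocart _ _ _).trans (L_rightCounitCell f).symm) ≫ (runit _).hom)
    (by simp [L_comp, L_hmap, L_lunit_inv, L_runit, L_cocart])
    (by simp [R_comp, R_hmap, R_lunit_inv, R_runit, R_rightCounitCell])
  let p : End (U A) := ofCell ((lunit (U A)).inv ≫ (runit (U A)).hom)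
    (by simp [L_comp, L_lunit_inv, L_runit]) (by simp [R_comp, R_lunit_inv, R_runit])
  have hκ (γ : of (U A) ⟶ of (ext (𝟙 A) f (U A))) (hγ : L γ = 𝟙 A) :
      hmap (rightUnitCell f) (γ ≫ rightCounitCell f)
        (by simp [L_comp, hγ, L_rightCounitCell, R_cocart]) ≫ (runit _).hom =
      (lunit (U A)).hom ≫ γ ≫ toCell κ := by
    have : (lunit (U A)).hom ≫ γ ≫ toCell κ = ((lunit (U A)).hom ≫ γ) ≫ toCell κ := by simp
    rw [this, ← lunit_nat γ hγ, toCell_ofCell, Category.assoc, Iso.hom_inv_id_assoc,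
      ← Category.assoc, hmap_comp_hmap]
    congr 1
    exact hmap_congr (by simp) rfl _ _
  have hp : κ = extEnd (𝟙 A) f (U A) p := by
    refine ext_hom_ext ((cancel_epi (lunit (U A)).hom).1 ?_)
    have e : cocart (𝟙 A) f (U A) ≫ toCell (extEnd (𝟙 A) f (U A) p) =
      toCell p ≫ rightUnitCell f := cocart_extension_map (𝟙 A) f p
    rw [e, ← hκ _ (L_cocart _ _ _)]
    have e2 : (lunit (U A)).hom ≫ toCell p ≫ rightUnitCell f =
        (runit (U A)).hom ≫ rightUnitCell f := by simp [p]
    rw [e2, ← hmap_Umap_runit (rightUnitCell f) (R_cocart _ _ _)]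
    congr 1
    exact hmap_congr rfl (rightUnitCell_counit f) _ _
  have hc : toCell β ≫ toCell κ = toCell κ ≫ toCell β := by
    rw [hp]
    exact congrArg toCell (rightExt_central f p β)
  have e : rightUnitCell f ≫ toCell (extEnd (𝟙 A) f (U A) p) =
      toCell p ≫ rightUnitCell f := cocart_extension_map (𝟙 A) f p
  refine (congrArg (· ≫ (runit _).hom) (hmap_congr rfl (Category.assoc _ _ _).symm _ _)).trans
    ((hκ (rightUnitCell f ≫ toCell β) (by simp [L_comp, L_cocart, L_toCell])).trans ?_)
  rw [Category.assoc, hc, hp, ← Category.assoc (rightUnitCell f), e]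
  simp [p]

lemma exists_isMate_right (f : A ⟶ B) (α : End (ext f (𝟙 A) (U A))) : ∃ β, IsMate f α β := by
  let x : of (U A) ⟶ of (ext (𝟙 A) f (U A)) := (runit (U A)).inv ≫
    hmap (rightUnitCell f) (leftTranspose f α)
      ((R_cocart _ _ _).trans (L_leftTranspose f α).symm) ≫ (runit _).hom
  have hxL : L x = 𝟙 A := by simp [x, L_comp, L_runit_inv, L_runit, L_hmap, L_cocart]
  have hxR : R x = f := by simp [x, R_comp, R_runit_inv, R_runit, R_hmap, R_leftTranspose]
  obtain ⟨β, ⟨h1, h2, h3⟩, -⟩ := isCocartesian_cocart (𝟙 A) f (U A) x (𝟙 A) (𝟙 B)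
    (by simp [hxL, L_cocart]) (by simp [hxR, R_cocart])
  refine ⟨ofCell β h1 h2, hmap_eq_of_middle_unit (m := leftTranspose f α)
    ((R_cocart _ _ _).trans (L_leftTranspose f α).symm)
    ((R_leftTranspose f α).trans (L_cocart _ _ _).symm) _ _ ?_ (leftTranspose_hmap α)⟩
  rw [toCell_ofCell, h3, Iso.hom_inv_id_assoc]

lemma exists_isMate_left (f : A ⟶ B) (β : End (ext (𝟙 A) f (U A))) : ∃ α, IsMate f α β := by
  let x : of (U A) ⟶ of (ext f (𝟙 A) (U A)) := (lunit (U A)).inv ≫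
    hmap (rightTranspose f β) (leftUnitCell f)
      ((R_rightTranspose f β).trans (L_cocart _ _ _).symm) ≫ (lunit _).hom
  have hxR : R x = 𝟙 A := by simp [x, R_comp, R_lunit_inv, R_lunit, R_hmap, R_cocart]
  have hxL : L x = f := by simp [x, L_comp, L_lunit_inv, L_lunit, L_hmap, L_rightTranspose]
  obtain ⟨α, ⟨h1, h2, h3⟩, -⟩ := isCocartesian_cocart f (𝟙 A) (U A) x (𝟙 B) (𝟙 A)
    (by simp [hxL, L_cocart]) (by simp [hxR, R_cocart])
  refine ⟨ofCell α h1 h2, hmap_eq_of_middle_unit (m := rightTranspose f β)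
    ((R_cocart _ _ _).trans (L_rightTranspose f β).symm)
    ((R_rightTranspose f β).trans (L_cocart _ _ _).symm) _ _ (rightTranspose_hmap β) ?_⟩
  rw [toCell_ofCell, h3, Iso.hom_inv_id_assoc]

/-- The ring isomorphism `End (f_! U_A) ≅ End (U_A f_!)ᵒᵖ` sending an endomorphism to its mate. -/
noncomputable def swap (f : A ⟶ B) : LeftEnd f ≃+* (RightEnd f)ᵐᵒᵖ where
  toFun α := MulOpposite.op (exists_isMate_right f α).choose
  invFun β := (exists_isMate_left f β.unop).choose
  left_inv α := (exists_isMate_left f _).choose_spec.left_unique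
    (exists_isMate_right f α).choose_spec
  right_inv β := MulOpposite.unop_injective <| (exists_isMate_right f _).choose_spec.right_unique
    (exists_isMate_left f β.unop).choose_spec
  map_mul' α α' := MulOpposite.unop_injective <|
    (exists_isMate_right f _).choose_spec.right_unique
      ((exists_isMate_right f α).choose_spec.mul (exists_isMate_right f α').choose_spec)
  map_add' α α' := MulOpposite.unop_injective <|
    (exists_isMate_right f _).choose_spec.right_unique
      ((exists_isMate_right f α).choose_spec.add (exists_isMate_right f α').choose_spec)

lemma isMate_swap (f : A ⟶ B) (α : LeftEnd f) : IsMate f α (swap f α).unop :=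
  (exists_isMate_right f α).choose_spec

lemma swap_eq_of_isMate {α : LeftEnd f} {β : RightEnd f} (h : IsMate f α β) :
    (swap f α).unop = β :=
  (isMate_swap f α).right_unique h

/-- `swap f` as an isomorphism of `End U_A`-algebras. -/
noncomputable def swapAlg (f : A ⟶ B) : (LeftEnd f)ᵐᵒᵖ ≃ₐ[End (U A)] RightEnd f :=
  AlgEquiv.ofRingEquiv
    (f := (swap f).op.trans (RingEquiv.opOp (RightEnd f)).symm)
    fun p => swap_eq_of_isMate (IsMate.extEnd p)

section Initial

variable {I : V} (hI : IsInitial I)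

/-- Mates are preserved by change of the target 0-cell. -/
lemma IsMate.pushEnd_hat {A B : V} (g : A ⟶ B) {α : LeftEnd (hI.to A)} {β : RightEnd (hI.to A)}
    (h : IsMate (hI.to A) α β) :
    IsMate (hI.to B) (leftAlgMap hI g α) (rightAlgMap hI g β) := by
  have hα : leftHat hI g ≫ toCell (leftAlgMap hI g α : End _) = toCell α ≫ leftHat hI g :=
    comp_pushEnd (isCocartesian_leftHat hI g) α
  have hβ : rightHat hI g ≫ toCell (rightAlgMap hI g β : End _) = toCell β ≫ rightHat hI g :=
    comp_pushEnd (isCocartesian_rightHat hI g) β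
  have h' := congrArg (· ≫ hmap (rightHat hI g) (leftHat hI g)
    (by rw [leftHat, rightHat, IsCocartesian.R_desc, IsCocartesian.L_desc])) h
  simp only [hmap_comp_hmap, Category.assoc] at h'
  refine Eq.trans (hmap_congr ?_ ?_ _ _) (h'.trans (hmap_congr ?_ ?_ _ _))
  · exact (cocart_rightHat hI g).symm
  · rw [← hα, ← Category.assoc, cocart_leftHat]
  · rw [← hβ, ← Category.assoc, cocart_rightHat]
  · exact cocart_leftHat hI g

/-- The natural isomorphism `R(-, I)ᵒᵖ ≅ R(I, -)` with components `swap`. -/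
noncomputable def swapIso : leftR hI ⋙ algOp _ ≅ rightR hI :=
  NatIso.ofComponents (fun B => (swapAlg (hI.to B)).toAlgebraIso) (by
    intro A B g
    ext α
    exact swap_eq_of_isMate ((isMate_swap (hI.to A) α.unop).pushEnd_hat hI g))

end Initial

end AbelianFramed

end FramedBicat

theorem proposition7p34 {V : Type u} [CategoryTheory.Category.{v} V]
    [FramedBicat.FramedBicategory.{w, z} V] [FramedBicat.AbelianFramed V]
    {I : V} (hI : CategoryTheory.Limits.IsInitial I) (hV : FramedBicat.IsModuleLike V hI) :
    ∃ swap : ∀ {A B : V} (f : A ⟶ B),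
        FramedBicat.LeftEnd f ≃+* (FramedBicat.RightEnd f)ᵐᵒᵖ,
      ∃ θ : FramedBicat.leftR hI ⋙ FramedBicat.algOp _ ≅ FramedBicat.rightR hI,
        ∀ (B : V) (α : FramedBicat.LeftEnd (hI.to B)),
          (θ.hom.app B).hom (MulOpposite.op α) = (swap (hI.to B) α).unop :=
  ⟨FramedBicat.swap, FramedBicat.swapIso hI, fun _ _ => rfl⟩
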